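/- Let $\mathcal C\subseteq\mathbb F_2^N$ be a binary linear code of length $N$. A codeword $X$ is chosen uniformly at random from $\mathcal C$ and sent over the binary erasure channel BEC$(\epsilon)$, which independently erases each bit with probability $\epsilon$ and otherwise delivers it unchanged; let $Y\in\{0,1,?\}^N$ be the received word and $p(y\mid x)$ the transition probability. Let $P_{\rm MAP}(\epsilon)$ be the block-MAP error probability, where a tie counts as an error: it is the probability that $X$ is not the unique maximizer of $x\mapsto p(Y\mid x)$ over $x\in\mathcal C$ (for $0<\epsilon<1$: the probability that the set of erased positions contains the support of some non-zero codeword). Let $A(w)$ be the number of codewords of Hamming weight $w$, and let $A(W,z)=\sum_{w=1}^{W}A(w)z^w$. Let $\Phi(x)=\int_{-\infty}^x\frac1{\sqrt{2\pi}}e^{-u^2/2}\,du$. Suppose that $0<\epsilon^*<1$ and $P_{\rm MAP}(\epsilon^*)=\frac12$. Then for every integer $1\le W\le N$ the following hold. For every $0<\epsilon<\epsilon^*$, $$P_{\rm MAP}(\epsilon)\le \Phi\!\left(\sqrt W\left(\sqrt{-\ln \epsilon^*}-\sqrt{-\ln\epsilon}\right)\right)+2\sqrt{-\ln\epsilon}\,\sqrt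 W\,A(W,\epsilon^*).$$ For every $\epsilon^*<\epsilon<1$, $$P_{\rm MAP}(\epsilon)\ge \Phi\!\left(\sqrt W\left(\sqrt{-\ln \epsilon^*}-\sqrt{-\ln\epsilon}\right)\right)-2\sqrt{-\ln\epsilon^*}\,\sqrt W\,A(W,\epsilon).$$ -/

import Mathlib

/-- Transition probability of one use of the binary erasure channel with erasure probability `ε`:
the output `none` is the erasure symbol, and `some c` is the received bit `c`. -/
noncomputable def becLetter (ε : ℝ) (a : ZMod 2) : Option (ZMod 2) → ℝ
  | none => ε
  | some c => if c = a then 1 - ε else 0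

/-- Transition probability `p(y | x)` of `N` independent uses of the binary erasure channel. -/
noncomputable def becProb {N : ℕ} (ε : ℝ) (x : Fin N → ZMod 2) (y : Fin N → Option (ZMod 2)) : ℝ :=
  ∏ i, becLetter ε (x i) (y i)

/-- A block-MAP error occurs when `x` is sent and `y` is received: some other codeword is at least
as likely as `x`, that is, `x` is not the unique maximizer of `p(y | ·)` over the code. -/
def IsBlockMAPError {N : ℕ} (C : Submodule (ZMod 2) (Fin N → ZMod 2)) (ε : ℝ)
    (x : Fin N → ZMod 2) (y : Fin N → Option (ZMod 2)) : Prop :=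
  ∃ x' ∈ C, x' ≠ x ∧ becProb ε x y ≤ becProb ε x' y

open Classical in
/-- The block-MAP error probability: the codeword is uniform on `C`, and it is sent over the binary
erasure channel with erasure probability `ε`. -/
noncomputable def blockMAPErrorProb {N : ℕ} (C : Submodule (ZMod 2) (Fin N → ZMod 2))
    (ε : ℝ) : ℝ :=
  ∑ x : C, (1 / (Fintype.card C : ℝ)) *
    ∑ y : Fin N → Option (ZMod 2),
      if IsBlockMAPError C ε (x : Fin N → ZMod 2) y then becProb ε (x : Fin N → ZMod 2) y else 0

/-- The weight distribution `A(w)`: the number of codewords of Hamming weight `w`. -/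
noncomputable def weightDistribution {N : ℕ} (C : Submodule (ZMod 2) (Fin N → ZMod 2))
    (w : ℕ) : ℕ :=
  Set.ncard {x : Fin N → ZMod 2 | x ∈ C ∧ hammingNorm x = w}

/-- The truncated weight enumerator `A(W, z) = ∑_{w=1}^W A(w) z^w`. -/
noncomputable def truncWeightEnumerator {N : ℕ} (C : Submodule (ZMod 2) (Fin N → ZMod 2))
    (W : ℕ) (z : ℝ) : ℝ :=
  ∑ w ∈ Finset.Icc 1 W, (weightDistribution C w : ℝ) * z ^ w

/-- The cumulative distribution function of the standard normal distribution. -/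
noncomputable def stdNormalCDF (x : ℝ) : ℝ :=
  ∫ u in Set.Iic x, 1 / Real.sqrt (2 * Real.pi) * Real.exp (-u ^ 2 / 2)

/-!
Erasing positions independently turns the error probability into the probability `P(p)` of an
increasing set of the discrete cube: the erasure patterns covering a nonzero codeword. Let `h` be
the number of pivotal positions of such a pattern. The Margulis–Russo formula gives
`p P'(p) = E h`, and a Gaussian isoperimetric inequality bounds the profile `I = φ ∘ Φ⁻¹` by
`I(P) ≤ 2 √(-log p) E √h`. Where `h > W` we have `h ≥ √W √h`. Where `1 ≤ h ≤ W` the pivotal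
positions are the support of the only covered codeword, so these patterns contribute at most
`∑_{w ≤ W} √w A(w) p ^ w` to `E √h`. Altogether
`p P' + √W ∑_{w ≤ W} √w A(w) p ^ w ≥ √W I(P) / (2 √(-log p))`, to be compared with the curve
`Φ(√W (√(-log εs) - √(-log p)))`, which takes the value `1 / 2` at `εs` and solves the
corresponding differential equation without the sum.
-/

open Filter Set Topology

section Gaussian

/-- The density `φ` of the standard normal distribution. -/
noncomputable abbrev stdNormalPDF : ℝ → ℝ := ProbabilityTheory.gaussianPDFReal 0 1

lemma stdNormalPDF_apply (u : ℝ) :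
    stdNormalPDF u = 1 / √(2 * Real.pi) * Real.exp (-u ^ 2 / 2) := by
  simp [ProbabilityTheory.gaussianPDFReal]

lemma stdNormalPDF_pos (u : ℝ) : 0 < stdNormalPDF u :=
  ProbabilityTheory.gaussianPDFReal_pos 0 1 u one_ne_zero

lemma integrable_stdNormalPDF : MeasureTheory.Integrable stdNormalPDF :=
  ProbabilityTheory.integrable_gaussianPDFReal 0 1

lemma stdNormalPDF_neg (u : ℝ) : stdNormalPDF (-u) = stdNormalPDF u := by
  simp only [stdNormalPDF_apply, neg_sq]

lemma stdNormalPDF_le_of_abs_le {u v : ℝ} (h : |v| ≤ |u|) : stdNormalPDF u ≤ stdNormalPDF v := by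
  rw [stdNormalPDF_apply, stdNormalPDF_apply]
  have := sq_le_sq.2 h
  gcongr

lemma hasDerivAt_stdNormalPDF (u : ℝ) : HasDerivAt stdNormalPDF (-u * stdNormalPDF u) u := by
  have hexponent : HasDerivAt (fun u : ℝ => -u ^ 2 / 2) (-u) u :=
    ((hasDerivAt_pow 2 u).neg.div_const 2).congr_deriv (by simp [neg_div])
  refine ((hexponent.exp.const_mul (1 / √(2 * Real.pi))).congr_deriv ?_).congr_of_eventuallyEq
    (Eventually.of_forall stdNormalPDF_apply)
  rw [stdNormalPDF_apply]
  ring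

lemma continuous_stdNormalPDF : Continuous stdNormalPDF :=
  continuous_iff_continuousAt.2 fun u => (hasDerivAt_stdNormalPDF u).continuousAt

lemma tendsto_stdNormalPDF_atBot : Tendsto stdNormalPDF atBot (𝓝 0) := by
  have hsq : Tendsto (fun u : ℝ => u ^ 2 / 2) atBot atTop := by
    simpa only [Function.comp_def, sq_abs] using
      ((tendsto_pow_atTop two_ne_zero).comp (tendsto_abs_atBot_atTop (G := ℝ))).atTop_div_const
        two_pos
  have h := (Real.tendsto_exp_neg_atTop_nhds_zero.comp hsq).const_mul (1 / √(2 * Real.pi))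
  rw [mul_zero] at h
  exact h.congr fun u => by rw [stdNormalPDF_apply, neg_div, Function.comp_apply]

lemma stdNormalCDF_eq_integral (x : ℝ) : stdNormalCDF x = ∫ u in Iic x, stdNormalPDF u := by
  simp only [stdNormalCDF, stdNormalPDF_apply]

lemma stdNormalCDF_eq_cdf :
    stdNormalCDF = ProbabilityTheory.cdf (ProbabilityTheory.gaussianReal 0 1) := by
  ext x
  rw [ProbabilityTheory.cdf_eq_real, MeasureTheory.measureReal_def,
    ProbabilityTheory.gaussianReal_apply_eq_integral 0 one_ne_zero,
    ENNReal.toReal_ofReal (MeasureTheory.integral_nonneg fun u => (stdNormalPDF_pos u).le),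
    stdNormalCDF_eq_integral]

lemma hasDerivAt_stdNormalCDF (x : ℝ) : HasDerivAt stdNormalCDF (stdNormalPDF x) x := by
  have hFTC := (continuous_stdNormalPDF.integral_hasStrictDerivAt 0 x).hasDerivAt.const_add
    (stdNormalCDF 0)
  refine hFTC.congr_of_eventuallyEq (Eventually.of_forall fun y => ?_)
  beta_reduce
  rw [stdNormalCDF_eq_integral, stdNormalCDF_eq_integral,
    ← intervalIntegral.integral_Iic_sub_Iic integrable_stdNormalPDF.integrableOn
      integrable_stdNormalPDF.integrableOn, add_sub_cancel]

lemma continuous_stdNormalCDF : Continuous stdNormalCDF :=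
  continuous_iff_continuousAt.2 fun x => (hasDerivAt_stdNormalCDF x).continuousAt

lemma strictMono_stdNormalCDF : StrictMono stdNormalCDF :=
  strictMono_of_deriv_pos fun x =>
    (hasDerivAt_stdNormalCDF x).deriv.symm ▸ stdNormalPDF_pos x

lemma stdNormalCDF_neg (x : ℝ) : stdNormalCDF (-x) = 1 - stdNormalCDF x := by
  have htail : stdNormalCDF (-x) = ∫ u in Ioi x, stdNormalPDF u := by
    rw [stdNormalCDF_eq_integral, ← integral_comp_neg_Ioi]
    simp only [stdNormalPDF_neg]
  have htotal := MeasureTheory.integral_add_compl (measurableSet_Iic (a := x))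
    integrable_stdNormalPDF
  rw [compl_Iic, ProbabilityTheory.integral_gaussianPDFReal_eq_one 0 one_ne_zero] at htotal
  rw [htail, stdNormalCDF_eq_integral, ← htotal, add_sub_cancel_left]

lemma stdNormalCDF_zero : stdNormalCDF 0 = 1 / 2 := by
  have := stdNormalCDF_neg 0
  rw [neg_zero] at this
  linarith

lemma range_stdNormalCDF : range stdNormalCDF = Ioo 0 1 := by
  apply Subset.antisymm
  · rintro _ ⟨u, rfl⟩
    refine ⟨lt_of_le_of_lt ?_ (strictMono_stdNormalCDF (sub_one_lt u)),
      (strictMono_stdNormalCDF (lt_add_one u)).trans_le ?_⟩ <;> rw [stdNormalCDF_eq_cdf]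
    exacts [ProbabilityTheory.cdf_nonneg _ _, ProbabilityTheory.cdf_le_one _ _]
  · rintro x ⟨h0, h1⟩
    have hbot : Tendsto stdNormalCDF atBot (𝓝 0) :=
      stdNormalCDF_eq_cdf ▸ ProbabilityTheory.tendsto_cdf_atBot _
    have htop : Tendsto stdNormalCDF atTop (𝓝 1) :=
      stdNormalCDF_eq_cdf ▸ ProbabilityTheory.tendsto_cdf_atTop _
    exact mem_range_of_exists_le_of_exists_ge continuous_stdNormalCDF
      (hbot.eventually (ge_mem_nhds h0)).exists (htop.eventually (le_mem_nhds h1)).exists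

lemma stdNormalCDF_mem_Ioo (u : ℝ) : stdNormalCDF u ∈ Ioo 0 1 :=
  range_stdNormalCDF ▸ mem_range_self u

/-- The quantile function `Φ⁻¹` of the standard normal distribution. It is meaningful on `(0, 1)`
only: elsewhere `Function.invFun` returns an arbitrary value. -/
noncomputable def stdNormalQuantile : ℝ → ℝ := Function.invFun stdNormalCDF

lemma stdNormalQuantile_stdNormalCDF (u : ℝ) : stdNormalQuantile (stdNormalCDF u) = u :=
  Function.leftInverse_invFun strictMono_stdNormalCDF.injective u

lemma stdNormalCDF_stdNormalQuantile {x : ℝ} (hx : x ∈ Ioo 0 1) :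
    stdNormalCDF (stdNormalQuantile x) = x :=
  Function.invFun_eq (range_stdNormalCDF.symm ▸ hx : x ∈ range stdNormalCDF)

lemma strictMonoOn_stdNormalQuantile : StrictMonoOn stdNormalQuantile (Ioo 0 1) :=
  fun x hx y hy hxy => by
    rwa [← strictMono_stdNormalCDF.lt_iff_lt, stdNormalCDF_stdNormalQuantile hx,
      stdNormalCDF_stdNormalQuantile hy]

lemma hasDerivAt_stdNormalQuantile {x : ℝ} (hx : x ∈ Ioo 0 1) :
    HasDerivAt stdNormalQuantile (stdNormalPDF (stdNormalQuantile x))⁻¹ x := by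
  have hnhds : Ioo (0 : ℝ) 1 ∈ 𝓝 x := isOpen_Ioo.mem_nhds hx
  have himage : stdNormalQuantile '' Ioo 0 1 = univ := eq_univ_of_forall fun u =>
    ⟨stdNormalCDF u, stdNormalCDF_mem_Ioo u, stdNormalQuantile_stdNormalCDF u⟩
  have hcont : ContinuousAt stdNormalQuantile x :=
    strictMonoOn_stdNormalQuantile.continuousAt_of_image_mem_nhds hnhds (himage ▸ univ_mem)
  exact HasDerivAt.of_local_left_inverse hcont (hasDerivAt_stdNormalCDF _)
    (stdNormalPDF_pos _).ne' (mem_of_superset hnhds fun _ => stdNormalCDF_stdNormalQuantile)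

/-- The Gaussian isoperimetric profile `φ ∘ Φ⁻¹`, extended by zero outside `(0, 1)`. -/
noncomputable def gaussianProfile : ℝ → ℝ :=
  (Ioo 0 1).indicator (stdNormalPDF ∘ stdNormalQuantile)

lemma gaussianProfile_of_mem {x : ℝ} (hx : x ∈ Ioo 0 1) :
    gaussianProfile x = stdNormalPDF (stdNormalQuantile x) := indicator_of_mem hx _

lemma gaussianProfile_of_notMem {x : ℝ} (hx : x ∉ Ioo 0 1) : gaussianProfile x = 0 :=
  indicator_of_notMem hx _

lemma gaussianProfile_zero : gaussianProfile 0 = 0 := gaussianProfile_of_notMem (by simp)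

lemma gaussianProfile_one : gaussianProfile 1 = 0 := gaussianProfile_of_notMem (by simp)

lemma gaussianProfile_stdNormalCDF (u : ℝ) :
    gaussianProfile (stdNormalCDF u) = stdNormalPDF u := by
  rw [gaussianProfile_of_mem (stdNormalCDF_mem_Ioo u), stdNormalQuantile_stdNormalCDF]

lemma gaussianProfile_nonneg (x : ℝ) : 0 ≤ gaussianProfile x :=
  indicator_nonneg (fun _ _ => (stdNormalPDF_pos _).le) x

lemma gaussianProfile_one_sub (x : ℝ) : gaussianProfile (1 - x) = gaussianProfile x := by
  by_cases hx : x ∈ Ioo 0 1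
  · obtain ⟨u, rfl⟩ := range_stdNormalCDF.symm ▸ hx
    rw [← stdNormalCDF_neg, gaussianProfile_stdNormalCDF, gaussianProfile_stdNormalCDF,
      stdNormalPDF_neg]
  · rw [gaussianProfile_of_notMem hx, gaussianProfile_of_notMem]
    exact fun h => hx ⟨by linarith [h.2], by linarith [h.1]⟩

lemma monotoneOn_gaussianProfile : MonotoneOn gaussianProfile (Iic (1 / 2)) := by
  intro x _ y (hy : y ≤ 1 / 2) hxy
  rcases le_or_gt x 0 with hx | hx
  · rw [gaussianProfile_of_notMem fun h => h.1.not_ge hx]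
    exact gaussianProfile_nonneg y
  have hxI : x ∈ Ioo (0 : ℝ) 1 := ⟨hx, by linarith⟩
  have hyI : y ∈ Ioo (0 : ℝ) 1 := ⟨hx.trans_le hxy, by linarith⟩
  rw [← range_stdNormalCDF] at hxI hyI
  obtain ⟨u, rfl⟩ := hxI
  obtain ⟨v, rfl⟩ := hyI
  rw [← stdNormalCDF_zero] at hy
  have huv : u ≤ v := strictMono_stdNormalCDF.le_iff_le.1 hxy
  have hv : v ≤ 0 := strictMono_stdNormalCDF.le_iff_le.1 hy
  rw [gaussianProfile_stdNormalCDF, gaussianProfile_stdNormalCDF]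
  exact stdNormalPDF_le_of_abs_le (abs_le_abs_of_nonpos hv huv)

lemma antitoneOn_gaussianProfile : AntitoneOn gaussianProfile (Ici (1 / 2)) := by
  intro x (hx : 1 / 2 ≤ x) y (hy : 1 / 2 ≤ y) hxy
  rw [← gaussianProfile_one_sub x, ← gaussianProfile_one_sub y]
  exact monotoneOn_gaussianProfile (by simp only [mem_Iic]; linarith)
    (by simp only [mem_Iic]; linarith) (by linarith)

lemma hasDerivAt_gaussianProfile {x : ℝ} (hx : x ∈ Ioo 0 1) :
    HasDerivAt gaussianProfile (-stdNormalQuantile x) x := by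
  have h := (hasDerivAt_stdNormalPDF (stdNormalQuantile x)).comp x (hasDerivAt_stdNormalQuantile hx)
  rw [mul_assoc, mul_inv_cancel₀ (stdNormalPDF_pos _).ne', mul_one] at h
  exact h.congr_of_eventuallyEq
    (mem_of_superset (isOpen_Ioo.mem_nhds hx) fun _ => gaussianProfile_of_mem)

lemma continuousAt_gaussianProfile_of_nonpos {x : ℝ} (hx : x ≤ 0) :
    ContinuousAt gaussianProfile x := by
  rw [ContinuousAt, gaussianProfile_of_notMem fun h => h.1.not_ge hx]
  refine tendsto_order.2 ⟨fun a ha => Eventually.of_forall fun y =>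
    ha.trans_le (gaussianProfile_nonneg y), fun a ha => ?_⟩
  obtain ⟨u, hua, hu⟩ := ((tendsto_stdNormalPDF_atBot.eventually (gt_mem_nhds ha)).and
    (eventually_le_atBot 0)).exists
  have hu_half : stdNormalCDF u ≤ 1 / 2 :=
    stdNormalCDF_zero ▸ strictMono_stdNormalCDF.monotone hu
  filter_upwards [ge_mem_nhds (hx.trans_lt (stdNormalCDF_mem_Ioo u).1)] with y hy
  calc gaussianProfile y ≤ gaussianProfile (stdNormalCDF u) :=
        monotoneOn_gaussianProfile (hy.trans hu_half) hu_half hy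
    _ = stdNormalPDF u := gaussianProfile_stdNormalCDF u
    _ < a := hua

lemma continuous_gaussianProfile : Continuous gaussianProfile := by
  refine continuous_iff_continuousAt.2 fun x => ?_
  rcases le_or_gt x 0 with h0 | h0
  · exact continuousAt_gaussianProfile_of_nonpos h0
  rcases le_or_gt 1 x with h1 | h1
  · have h : ContinuousAt (fun y : ℝ => gaussianProfile (1 - y)) x :=
      (continuousAt_gaussianProfile_of_nonpos (sub_nonpos.2 h1)).comp
        (f := fun y : ℝ => 1 - y) (by fun_prop)
    simpa only [gaussianProfile_one_sub] using h
  · exact (hasDerivAt_gaussianProfile ⟨h0, h1⟩).continuousAt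

end Gaussian

section TwoPoint

lemma not_isLocalMin_of_deriv_deriv_neg {f : ℝ → ℝ} {x : ℝ} (hf : deriv (deriv f) x < 0)
    (hc : ContinuousAt f x) : ¬ IsLocalMin f x := by
  intro hmin
  have hmax : IsLocalMax f x := isLocalMax_of_deriv_deriv_neg hf hmin.deriv_eq_zero hc
  have hconst : f =ᶠ[𝓝 x] fun _ => f x := hmax.mp (hmin.mono fun _ h h' => le_antisymm h' h)
  have hderiv : deriv f =ᶠ[𝓝 x] fun _ => 0 := by simpa only [deriv_const'] using hconst.deriv
  rw [hderiv.deriv_eq, deriv_const] at hf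
  exact hf.false

lemma nonneg_of_neg_imp_second_deriv_neg {f f' f'' : ℝ → ℝ} {a b : ℝ}
    (hc : ContinuousOn f (Icc a b)) (ha : 0 ≤ f a) (hb : 0 ≤ f b)
    (hf' : ∀ x ∈ Ioo a b, HasDerivAt f (f' x) x) (hf'' : ∀ x ∈ Ioo a b, HasDerivAt f' (f'' x) x)
    (hneg : ∀ x ∈ Ioo a b, f x < 0 → f'' x < 0) {x : ℝ} (hx : x ∈ Icc a b) : 0 ≤ f x := by
  by_contra! hfx
  obtain ⟨y, hy, hmin⟩ := isCompact_Icc.exists_isMinOn ⟨x, hx⟩ hc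
  have hfy : f y < 0 := (hmin hx).trans_lt hfx
  have hy' : y ∈ Ioo a b :=
    ⟨hy.1.lt_of_ne (by rintro rfl; exact hfy.not_ge ha),
      hy.2.lt_of_ne (by rintro rfl; exact hfy.not_ge hb)⟩
  have hderiv : deriv f =ᶠ[𝓝 y] f' :=
    mem_of_superset (isOpen_Ioo.mem_nhds hy') fun z hz => (hf' z hz).deriv
  refine not_isLocalMin_of_deriv_deriv_neg ?_ (hf' y hy').continuousAt
    (hmin.isLocalMin (Icc_mem_nhds hy'.1 hy'.2))
  rw [hderiv.deriv_eq, (hf'' y hy').deriv]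
  exact hneg y hy' hfy

/-- The square root on the right-hand side of the two-point inequality `gaussianProfile_two_point`,
as a function of the bias `q`. -/
noncomputable def twoPointRadical (B d q : ℝ) : ℝ := √(B ^ 2 + 4 * -Real.log q * d ^ 2)

variable {B d q : ℝ}

lemma twoPointRadical_one (hB : 0 ≤ B) : twoPointRadical B d 1 = B := by
  simp [twoPointRadical, Real.sqrt_sq hB]

lemma twoPointRadical_zero_right (hB : 0 ≤ B) : twoPointRadical B 0 q = B := by
  simp [twoPointRadical, Real.sqrt_sq hB]

lemma neg_log_pos (hq : q ∈ Ioo 0 1) : 0 < -Real.log q :=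
  neg_pos.2 (Real.log_neg hq.1 hq.2)

lemma twoPointRadicand_pos (hd : d ≠ 0) (hq : q ∈ Ioo 0 1) :
    0 < B ^ 2 + 4 * -Real.log q * d ^ 2 := by
  have := neg_log_pos hq
  positivity

lemma twoPointRadical_pos (hd : d ≠ 0) (hq : q ∈ Ioo 0 1) : 0 < twoPointRadical B d q :=
  Real.sqrt_pos.2 (twoPointRadicand_pos hd hq)

lemma hasDerivAt_twoPointRadical (hd : d ≠ 0) (hq : q ∈ Ioo 0 1) :
    HasDerivAt (twoPointRadical B d) (-(2 * d ^ 2) / (q * twoPointRadical B d q)) q := by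
  have h := ((((Real.hasDerivAt_log hq.1.ne').neg.const_mul 4).mul_const (d ^ 2)).const_add
    (B ^ 2)).sqrt (twoPointRadicand_pos hd hq).ne'
  refine h.congr_deriv ?_
  have := hq.1
  change _ / (2 * twoPointRadical B d q) = _
  field_simp
  ring

lemma hasDerivAt_mul_twoPointRadical (hd : d ≠ 0) (hq : q ∈ Ioo 0 1) :
    HasDerivAt (fun q => q * twoPointRadical B d q)
      (twoPointRadical B d q - 2 * d ^ 2 / twoPointRadical B d q) q := by
  refine ((hasDerivAt_id q).mul (hasDerivAt_twoPointRadical hd hq)).congr_deriv ?_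
  have := hq.1
  have := twoPointRadical_pos (B := B) hd hq
  simp only [id]
  field_simp
  ring

lemma hasDerivAt_deriv_mul_twoPointRadical (hd : d ≠ 0) (hq : q ∈ Ioo 0 1) :
    HasDerivAt (fun q => twoPointRadical B d q - 2 * d ^ 2 / twoPointRadical B d q)
      (-(2 * d ^ 2) / (q * twoPointRadical B d q) * (1 + 2 * d ^ 2 / twoPointRadical B d q ^ 2))
      q := by
  have hR := twoPointRadical_pos (B := B) hd hq
  have hR' := hasDerivAt_twoPointRadical (B := B) hd hq
  refine (hR'.sub ((hasDerivAt_const q (2 * d ^ 2)).div hR' hR.ne')).congr_deriv ?_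
  have := hq.1
  field_simp
  ring

/-- Pulling `q` under the root replaces the singular `log q` by the continuous `q * log q`. -/
lemma continuousOn_mul_twoPointRadical :
    ContinuousOn (fun q => q * twoPointRadical B d q) (Icc 0 1) := by
  have := Real.continuous_mul_log
  have hcont : Continuous fun q : ℝ => √(q ^ 2 * B ^ 2 + 4 * -(q * Real.log q) * q * d ^ 2) := by
    fun_prop
  refine hcont.continuousOn.congr fun q hq => ?_
  beta_reduce
  rw [twoPointRadical, ← Real.sqrt_sq hq.1, ← Real.sqrt_mul (sq_nonneg q), Real.sqrt_sq hq.1]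
  ring_nf

lemma add_mul_sub_mem_Ioo {a b : ℝ} (ha : a ∈ Icc 0 1) (hb : b ∈ Icc 0 1) (hab : a ≠ b)
    (hq : q ∈ Ioo 0 1) : a + q * (b - a) ∈ Ioo 0 1 := by
  obtain ⟨hq0, hq1⟩ := hq
  rcases hab.lt_or_gt with h | h
  · exact ⟨by nlinarith [ha.1], by nlinarith [hb.2]⟩
  · exact ⟨by nlinarith [hb.1], by nlinarith [ha.2]⟩

lemma hasDerivAt_gaussianProfile_line {a : ℝ} (h : a + q * d ∈ Ioo 0 1) :
    HasDerivAt (fun q => gaussianProfile (a + q * d)) (-stdNormalQuantile (a + q * d) * d) q := by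
  have hline := ((hasDerivAt_id q).mul_const d).const_add a
  rw [one_mul] at hline
  exact (hasDerivAt_gaussianProfile h).comp q hline

lemma hasDerivAt_deriv_gaussianProfile_line {a : ℝ} (h : a + q * d ∈ Ioo 0 1) :
    HasDerivAt (fun q => -stdNormalQuantile (a + q * d) * d)
      (-(d ^ 2 / gaussianProfile (a + q * d))) q := by
  have hline := ((hasDerivAt_id q).mul_const d).const_add a
  rw [one_mul] at hline
  refine (((hasDerivAt_stdNormalQuantile h).comp q hline).neg.mul_const d).congr_deriv ?_
  rw [← gaussianProfile_of_mem h]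
  ring

/-- Where `q R + (1 - q) A < I`, the second derivative of the difference is negative because
`(q R)'' ≤ -2 d² / (q R)` whereas `I'' = -d² / I`. -/
lemma second_deriv_two_point_neg {A I R : ℝ} (hd : d ≠ 0) (hq : q ∈ Ioo 0 1) (hA : 0 ≤ A)
    (hR : 0 < R) (hlt : q * R + (1 - q) * A - I < 0) :
    -(2 * d ^ 2) / (q * R) * (1 + 2 * d ^ 2 / R ^ 2) - -(d ^ 2 / I) < 0 := by
  have hA' : 0 ≤ (1 - q) * A := mul_nonneg (sub_nonneg.2 hq.2.le) hA
  have hqR : 0 < q * R := mul_pos hq.1 hR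
  have hcompare : d ^ 2 / I < d ^ 2 / (q * R) :=
    div_lt_div_of_pos_left (by positivity) hqR (by linarith)
  have hpos : 0 < d ^ 2 / (q * R) := by positivity
  have hexcess : 0 ≤ 2 * d ^ 2 / R ^ 2 := by positivity
  calc -(2 * d ^ 2) / (q * R) * (1 + 2 * d ^ 2 / R ^ 2) - -(d ^ 2 / I)
      = d ^ 2 / I - 2 * (d ^ 2 / (q * R)) * (1 + 2 * d ^ 2 / R ^ 2) := by ring
    _ < 0 := by nlinarith [mul_nonneg hpos.le hexcess]

lemma gaussianProfile_two_point {a b p : ℝ} (ha : a ∈ Icc 0 1) (hb : b ∈ Icc 0 1)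
    (hp : p ∈ Icc 0 1) :
    gaussianProfile (p * b + (1 - p) * a) ≤
      p * √(gaussianProfile b ^ 2 + 4 * -Real.log p * (b - a) ^ 2) +
        (1 - p) * gaussianProfile a := by
  rw [← twoPointRadical, show p * b + (1 - p) * a = a + p * (b - a) by ring]
  have hAnn := gaussianProfile_nonneg a
  have hBnn := gaussianProfile_nonneg b
  rcases eq_or_ne a b with rfl | hab
  · rw [sub_self, mul_zero, add_zero, twoPointRadical_zero_right hAnn]
    linarith
  have hd : b - a ≠ 0 := sub_ne_zero.2 hab.symm
  have hmem : ∀ q ∈ Ioo (0 : ℝ) 1, a + q * (b - a) ∈ Ioo 0 1 := fun q =>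
    add_mul_sub_mem_Ioo ha hb hab
  have hlinear : ∀ q, HasDerivAt (fun q => (1 - q) * gaussianProfile a) (-gaussianProfile a) q :=
    fun q => (((hasDerivAt_id q).const_sub 1).mul_const _).congr_deriv (neg_one_mul _)
  rw [← sub_nonneg]
  refine nonneg_of_neg_imp_second_deriv_neg
    (f := fun q => q * twoPointRadical (gaussianProfile b) (b - a) q +
      (1 - q) * gaussianProfile a - gaussianProfile (a + q * (b - a)))
    ?_ (by simp) (by simp [twoPointRadical_one hBnn])
    (fun q hq => ((hasDerivAt_mul_twoPointRadical hd hq).add (hlinear q)).sub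
      (hasDerivAt_gaussianProfile_line (hmem q hq)))
    (fun q hq => ((hasDerivAt_deriv_mul_twoPointRadical hd hq).add_const _).sub
      (hasDerivAt_deriv_gaussianProfile_line (hmem q hq)))
    (fun q hq => second_deriv_two_point_neg hd hq hAnn (twoPointRadical_pos hd hq)) hp
  have := continuous_gaussianProfile
  exact (continuousOn_mul_twoPointRadical.add (by fun_prop)).sub (by fun_prop)

end TwoPoint

section Bernoulli

/-- The expectation of `F` when the coordinates of the discrete cube are independent and each is
`true` with probability `p`. -/
noncomputable def bernoulliExp {ι : Type*} [Fintype ι] [DecidableEq ι] (p : ℝ)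
    (F : (ι → Bool) → ℝ) : ℝ :=
  ∑ x, (∏ i, if x i then p else 1 - p) * F x

/-- The probability of a set of the discrete cube when the coordinates are independent and each is
`true` with probability `p`. -/
noncomputable def bernoulliProb {ι : Type*} [Fintype ι] [DecidableEq ι] (p : ℝ)
    (S : Set (ι → Bool)) : ℝ :=
  bernoulliExp p (S.indicator 1)

section Fintype

lemma bernoulli_weight_nonneg {ι : Type*} [Fintype ι] {p : ℝ} (hp : p ∈ Icc 0 1) (x : ι → Bool) :
    0 ≤ ∏ i, if x i then p else 1 - p :=
  Finset.prod_nonneg fun _ _ => ite_nonneg hp.1 (sub_nonneg.2 hp.2)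

variable {ι : Type*} [Fintype ι] [DecidableEq ι] {p : ℝ}

lemma bernoulliExp_add (p : ℝ) (F G : (ι → Bool) → ℝ) :
    bernoulliExp p (fun x => F x + G x) = bernoulliExp p F + bernoulliExp p G := by
  simp only [bernoulliExp, mul_add, Finset.sum_add_distrib]

lemma bernoulliExp_const_mul (p c : ℝ) (F : (ι → Bool) → ℝ) :
    bernoulliExp p (fun x => c * F x) = c * bernoulliExp p F := by
  simp only [bernoulliExp, Finset.mul_sum, mul_left_comm]

lemma bernoulliExp_sum {κ : Type*} (s : Finset κ) (p : ℝ) (F : κ → (ι → Bool) → ℝ) :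
    bernoulliExp p (fun x => ∑ c ∈ s, F c x) = ∑ c ∈ s, bernoulliExp p (F c) := by
  simp only [bernoulliExp, Finset.mul_sum]
  exact Finset.sum_comm

lemma bernoulliExp_prod (p : ℝ) (g : ι → Bool → ℝ) :
    bernoulliExp p (fun x => ∏ i, g i (x i)) = ∏ i, (p * g i true + (1 - p) * g i false) := by
  simp only [bernoulliExp, ← Finset.prod_mul_distrib]
  rw [← Fintype.prod_sum fun i b => (if b = true then p else 1 - p) * g i b]
  simp

lemma bernoulliExp_const (p c : ℝ) : bernoulliExp p (fun _ : ι → Bool => c) = c := by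
  have h := bernoulliExp_prod (ι := ι) p fun _ _ => 1
  simp only [Finset.prod_const_one, mul_one, add_sub_cancel] at h
  simpa only [h, mul_one] using bernoulliExp_const_mul p c fun _ : ι → Bool => 1

lemma bernoulliExp_mono (hp : p ∈ Icc 0 1) {F G : (ι → Bool) → ℝ} (h : ∀ x, F x ≤ G x) :
    bernoulliExp p F ≤ bernoulliExp p G :=
  Finset.sum_le_sum fun x _ => mul_le_mul_of_nonneg_left (h x) (bernoulli_weight_nonneg hp x)

lemma bernoulliExp_nonneg (hp : p ∈ Icc 0 1) {F : (ι → Bool) → ℝ} (h : ∀ x, 0 ≤ F x) :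
    0 ≤ bernoulliExp p F :=
  (bernoulliExp_const p 0).symm.trans_le (bernoulliExp_mono hp h)

lemma sqrt_bernoulliExp_sq_add_sq_le (hp : p ∈ Icc 0 1) (u v : (ι → Bool) → ℝ) :
    √(bernoulliExp p u ^ 2 + bernoulliExp p v ^ 2) ≤
      bernoulliExp p (fun x => √(u x ^ 2 + v x ^ 2)) := by
  have hnorm : ∀ a b : ℝ, √(a ^ 2 + b ^ 2) = ‖(⟨a, b⟩ : ℂ)‖ := fun a b => by
    rw [Complex.norm_eq_sqrt_sq_add_sq]
  set weight : (ι → Bool) → ℝ := fun x => ∏ i, if x i then p else 1 - p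
  have hsum : (⟨bernoulliExp p u, bernoulliExp p v⟩ : ℂ) = ∑ x, weight x • (⟨u x, v x⟩ : ℂ) := by
    apply Complex.ext <;> simp only [bernoulliExp, Complex.re_sum, Complex.im_sum,
      Complex.smul_re, Complex.smul_im, smul_eq_mul, weight]
  calc √(bernoulliExp p u ^ 2 + bernoulliExp p v ^ 2)
      = ‖∑ x, weight x • (⟨u x, v x⟩ : ℂ)‖ := by rw [hnorm, hsum]
    _ ≤ ∑ x, ‖weight x • (⟨u x, v x⟩ : ℂ)‖ := norm_sum_le _ _
    _ = bernoulliExp p (fun x => √(u x ^ 2 + v x ^ 2)) :=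
        Finset.sum_congr rfl fun x _ => by
          rw [norm_smul, Real.norm_of_nonneg (bernoulli_weight_nonneg hp x), ← hnorm]

lemma bernoulliProb_mem_Icc (hp : p ∈ Icc 0 1) (S : Set (ι → Bool)) :
    bernoulliProb p S ∈ Icc 0 1 :=
  ⟨bernoulliExp_nonneg hp fun x => indicator_nonneg (fun _ _ => zero_le_one) x,
    (bernoulliExp_mono hp fun x => indicator_le_self' (fun _ _ => zero_le_one) x).trans_eq
      (bernoulliExp_const p 1)⟩

lemma bernoulliProb_add_bernoulliProb_diff (p : ℝ) {S T : Set (ι → Bool)} (h : T ⊆ S) :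
    bernoulliProb p T + bernoulliProb p (S \ T) = bernoulliProb p S := by
  rw [bernoulliProb, bernoulliProb, ← bernoulliExp_add,
    ← indicator_union_of_disjoint disjoint_sdiff_right, union_sdiff_cancel h, bernoulliProb]

lemma bernoulliProb_forall_mem_eq_true (p : ℝ) (s : Finset ι) :
    bernoulliProb p {x | ∀ i ∈ s, x i = true} = p ^ s.card := by
  have hprod : indicator {x : ι → Bool | ∀ i ∈ s, x i = true} 1 =
      fun x => ∏ i, if i ∈ s then (if x i = true then (1 : ℝ) else 0) else 1 := by
    ext x
    rw [Finset.prod_ite_mem, Finset.univ_inter, Finset.prod_boole]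
    simp [indicator_apply]
  rw [bernoulliProb, hprod,
    bernoulliExp_prod p fun i b => if i ∈ s then (if b = true then 1 else 0) else 1]
  calc ∏ i, (p * (if i ∈ s then (if true = true then 1 else 0) else 1) +
        (1 - p) * (if i ∈ s then (if false = true then 1 else 0) else 1))
      = ∏ i, if i ∈ s then p else 1 := Finset.prod_congr rfl fun i _ => by split_ifs <;> simp_all
    _ = p ^ s.card := by rw [Finset.prod_ite_mem, Finset.univ_inter, Finset.prod_const]

end Fintype

section Cube

variable {n : ℕ} {p : ℝ}

lemma bernoulliExp_zero (p : ℝ) (F : (Fin 0 → Bool) → ℝ) : bernoulliExp p F = F default := by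
  simp only [bernoulliExp, Finset.univ_eq_empty, Finset.prod_empty, one_mul]
  exact (Fintype.sum_unique F).trans (congrArg F (Subsingleton.elim _ _))

lemma bernoulliExp_succ (p : ℝ) (F : (Fin (n + 1) → Bool) → ℝ) :
    bernoulliExp p F = p * bernoulliExp p (fun x => F (Fin.cons true x)) +
      (1 - p) * bernoulliExp p (fun x => F (Fin.cons false x)) := by
  simp only [bernoulliExp]
  rw [← (Fin.consEquiv fun _ : Fin (n + 1) => Bool).sum_comp, Fintype.sum_prod_type]
  simp [Fin.consEquiv, Fin.prod_univ_succ, Finset.mul_sum, mul_assoc]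

/-- The section of a set of the discrete cube at the value `b` of the first coordinate; it drives
the inductions on the dimension. -/
def cubeSection (S : Set (Fin (n + 1) → Bool)) (b : Bool) : Set (Fin n → Bool) :=
  {x | (Fin.cons b x : Fin (n + 1) → Bool) ∈ S}

lemma bernoulliProb_succ (p : ℝ) (S : Set (Fin (n + 1) → Bool)) :
    bernoulliProb p S = p * bernoulliProb p (cubeSection S true) +
      (1 - p) * bernoulliProb p (cubeSection S false) :=
  bernoulliExp_succ p _

lemma isUpperSet_cubeSection {S : Set (Fin (n + 1) → Bool)} (hS : IsUpperSet S) (b : Bool) :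
    IsUpperSet (cubeSection S b) :=
  fun _ _ hxy hx => hS (Fin.cons_le_cons.2 ⟨le_rfl, hxy⟩) hx

lemma cubeSection_false_subset_true {S : Set (Fin (n + 1) → Bool)} (hS : IsUpperSet S) :
    cubeSection S false ⊆ cubeSection S true :=
  fun _ hx => hS (Fin.cons_le_cons.2 ⟨Bool.false_le _, le_rfl⟩) hx

open Classical in
/-- The coordinates that are pivotal for `S` at `x`, counted at the points of `S` only: those whose
change to `false` leads out of `S`. -/
noncomputable def pivotal (S : Set (Fin n → Bool)) (x : Fin n → Bool) : Finset (Fin n) :=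
  {i | x ∈ S ∧ Function.update x i false ∉ S}

lemma mem_pivotal {S : Set (Fin n → Bool)} {x : Fin n → Bool} {i : Fin n} :
    i ∈ pivotal S x ↔ x ∈ S ∧ Function.update x i false ∉ S := by
  simp [pivotal]

lemma card_pivotal_cons_true (S : Set (Fin (n + 1) → Bool)) (x : Fin n → Bool) :
    ((pivotal S (Fin.cons true x)).card : ℝ) = (pivotal (cubeSection S true) x).card +
      indicator (cubeSection S true \ cubeSection S false) 1 x := by
  classical
  simp only [pivotal, Fin.card_filter_univ_succ', Fin.update_cons_zero, ← Fin.cons_update,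
    cubeSection, indicator_apply, Set.mem_sdiff, mem_ofPred_eq, Pi.one_apply]
  push_cast
  rw [add_comm]
  congr

lemma card_pivotal_cons_false (S : Set (Fin (n + 1) → Bool)) (x : Fin n → Bool) :
    (pivotal S (Fin.cons false x)).card = (pivotal (cubeSection S false) x).card := by
  classical
  simp only [pivotal, Fin.card_filter_univ_succ', Fin.update_cons_zero, ← Fin.cons_update,
    cubeSection, mem_ofPred_eq, and_not_self, if_false, zero_add]
  congr

/-- The Margulis–Russo formula. -/
lemma hasDerivAt_bernoulliProb {S : Set (Fin n → Bool)} (hS : IsUpperSet S) (hp : p ≠ 0) :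
    HasDerivAt (fun q => bernoulliProb q S)
      (bernoulliExp p (fun x => ((pivotal S x).card : ℝ)) / p) p := by
  induction n with
  | zero =>
    simp only [bernoulliProb, bernoulliExp_zero]
    refine (hasDerivAt_const p _).congr_deriv ?_
    simp [Finset.eq_empty_of_isEmpty]
  | succ n ih =>
    have htrue := (hasDerivAt_id p).mul (ih (isUpperSet_cubeSection hS true))
    have hfalse := ((hasDerivAt_id p).const_sub 1).mul (ih (isUpperSet_cubeSection hS false))
    simp only [bernoulliProb_succ]
    refine (htrue.add hfalse).congr_deriv ?_
    rw [bernoulliExp_succ]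
    simp only [card_pivotal_cons_true, card_pivotal_cons_false]
    rw [bernoulliExp_add, ← bernoulliProb,
      ← bernoulliProb_add_bernoulliProb_diff p (cubeSection_false_subset_true hS)]
    simp only [id]
    field_simp
    ring

lemma monotoneOn_bernoulliProb {S : Set (Fin n → Bool)} (hS : IsUpperSet S) :
    MonotoneOn (fun p => bernoulliProb p S) (Ioo 0 1) := by
  have hderiv := fun p (hp : p ∈ Ioo (0 : ℝ) 1) => hasDerivAt_bernoulliProb hS hp.1.ne'
  refine monotoneOn_of_deriv_nonneg (convex_Ioo 0 1)
    (fun p hp => (hderiv p hp).continuousAt.continuousWithinAt) ?_ ?_ <;> rw [interior_Ioo]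
  · exact fun p hp => (hderiv p hp).differentiableAt.differentiableWithinAt
  · intro p hp
    rw [(hderiv p hp).deriv]
    exact div_nonneg (bernoulliExp_nonneg (Ioo_subset_Icc_self hp) fun x => Nat.cast_nonneg _)
      hp.1.le

lemma sqrt_sq_add_mul_bernoulliProb_sq_le (hp : p ∈ Icc 0 1) {c α : ℝ} (hc : 0 ≤ c) (hα : 0 ≤ α)
    {k : (Fin n → Bool) → ℝ} (hk : ∀ x, 0 ≤ k x) (h : α ≤ c * bernoulliExp p (fun x => √(k x)))
    (T : Set (Fin n → Bool)) :
    √(α ^ 2 + c ^ 2 * bernoulliProb p T ^ 2) ≤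
      c * bernoulliExp p (fun x => √(k x + T.indicator 1 x)) := by
  calc √(α ^ 2 + c ^ 2 * bernoulliProb p T ^ 2)
      ≤ √(c ^ 2 * (bernoulliExp p (fun x => √(k x)) ^ 2 + bernoulliProb p T ^ 2)) := by
        have hα2 : α ^ 2 ≤ c ^ 2 * bernoulliExp p (fun x => √(k x)) ^ 2 := by
          rw [← mul_pow]
          gcongr
        rw [mul_add]
        gcongr
    _ = c * √(bernoulliExp p (fun x => √(k x)) ^ 2 + bernoulliProb p T ^ 2) := by
        rw [Real.sqrt_mul (sq_nonneg c), Real.sqrt_sq hc]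
    _ ≤ c * bernoulliExp p (fun x => √(√(k x) ^ 2 + T.indicator 1 x ^ 2)) :=
        mul_le_mul_of_nonneg_left (sqrt_bernoulliExp_sq_add_sq_le hp _ _) hc
    _ = c * bernoulliExp p (fun x => √(k x + T.indicator 1 x)) := by
        congr! 4 with x
        rw [Real.sq_sqrt (hk x)]
        by_cases hx : x ∈ T <;> simp [hx]

lemma gaussianProfile_bernoulliProb_succ_le {S : Set (Fin (n + 1) → Bool)} (hS : IsUpperSet S)
    (hp : p ∈ Icc 0 1) :
    gaussianProfile (bernoulliProb p S) ≤
      p * √(gaussianProfile (bernoulliProb p (cubeSection S true)) ^ 2 +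
        4 * -Real.log p * bernoulliProb p (cubeSection S true \ cubeSection S false) ^ 2) +
        (1 - p) * gaussianProfile (bernoulliProb p (cubeSection S false)) := by
  have hdiff := bernoulliProb_add_bernoulliProb_diff p (cubeSection_false_subset_true hS)
  rw [bernoulliProb_succ, ← sub_eq_iff_eq_add'.2 hdiff.symm]
  exact gaussianProfile_two_point (bernoulliProb_mem_Icc hp _) (bernoulliProb_mem_Icc hp _) hp

/-- Tensorization of the two-point inequality: it is applied to the first coordinate, and
Minkowski's inequality then moves the root inside the expectation over the other ones. -/
lemma gaussianProfile_bernoulliProb_le {S : Set (Fin n → Bool)} (hS : IsUpperSet S)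
    (hp : p ∈ Icc 0 1) :
    gaussianProfile (bernoulliProb p S) ≤
      2 * √(-Real.log p) * bernoulliExp p (fun x => √(pivotal S x).card) := by
  have hlog : 0 ≤ -Real.log p := neg_nonneg.2 (Real.log_nonpos hp.1 hp.2)
  induction n with
  | zero =>
    rw [bernoulliProb, bernoulliExp_zero, bernoulliExp_zero]
    refine le_trans (le_of_eq ?_) (by positivity)
    by_cases h : default ∈ S
    · rw [indicator_of_mem h, Pi.one_apply, gaussianProfile_one]
    · rw [indicator_of_notMem h, gaussianProfile_zero]
  | succ n ih =>
    set S₁ := cubeSection S true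
    set S₀ := cubeSection S false
    set c := 2 * √(-Real.log p)
    have hsq : 4 * -Real.log p = c ^ 2 := by rw [mul_pow, Real.sq_sqrt hlog]; norm_num
    have hq : 0 ≤ 1 - p := sub_nonneg.2 hp.2
    calc gaussianProfile (bernoulliProb p S)
        ≤ p * √(gaussianProfile (bernoulliProb p S₁) ^ 2 + c ^ 2 * bernoulliProb p (S₁ \ S₀) ^ 2) +
          (1 - p) * gaussianProfile (bernoulliProb p S₀) := by
          rw [← hsq]
          exact gaussianProfile_bernoulliProb_succ_le hS hp
      _ ≤ p * (c * bernoulliExp p (fun x => √((pivotal S₁ x).card + (S₁ \ S₀).indicator 1 x))) +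
          (1 - p) * (c * bernoulliExp p (fun x => √(pivotal S₀ x).card)) := by
          gcongr
          · exact hp.1
          · exact sqrt_sq_add_mul_bernoulliProb_sq_le hp (by positivity) (gaussianProfile_nonneg _)
              (fun x => Nat.cast_nonneg _) (ih (isUpperSet_cubeSection hS true)) _
          · exact ih (isUpperSet_cubeSection hS false)
      _ = c * bernoulliExp p (fun x => √(pivotal S x).card) := by
          simp only [bernoulliExp_succ p fun x => √((pivotal S x).card : ℝ),
            card_pivotal_cons_true, card_pivotal_cons_false]
          ring

end Cube

end Bernoulli

section Comparison

variable {u u' ψ ψ' : ℝ → ℝ} {a b : ℝ}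

lemma right_le_sub_of_deriv_le_of_pos (hab : a ≤ b)
    (hu : ∀ x ∈ Icc a b, HasDerivAt u (u' x) x) (hψ : ∀ x ∈ Icc a b, HasDerivAt ψ (ψ' x) x)
    (hψ' : ∀ x ∈ Icc a b, 0 ≤ ψ' x) (h : ∀ x ∈ Icc a b, 0 < u x → u' x ≤ ψ' x)
    (ha : u a ≤ 0) : u b ≤ ψ b - ψ a := by
  have hmono : MonotoneOn ψ (Icc a b) := by
    refine monotoneOn_of_hasDerivWithinAt_nonneg (convex_Icc a b)
      (HasDerivAt.continuousOn hψ)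
      (fun x hx => (hψ x (interior_subset hx)).hasDerivWithinAt)
      fun x hx => hψ' x (interior_subset hx)
  refine le_of_forall_pos_le_add fun η hη => ?_
  -- The slack `δ (1 + x - a)` keeps the barrier positive and strictly steeper than `ψ`.
  set δ := η / (1 + b - a)
  have hδ : 0 < δ := div_pos hη (by linarith)
  have hbarrier : ∀ x ∈ Icc a b,
      HasDerivAt (fun x => ψ x - ψ a + δ * (1 + x - a)) (ψ' x + δ) x := fun x hx =>
    (((hψ x hx).sub_const (ψ a)).add ((((hasDerivAt_id x).const_add 1).sub_const a).const_mul
      δ)).congr_deriv (by rw [mul_one])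
  have hle := image_le_of_deriv_right_lt_deriv_boundary' (HasDerivAt.continuousOn hu)
    (fun x hx => (hu x (Ico_subset_Icc_self hx)).hasDerivWithinAt) (by simp; linarith)
    (HasDerivAt.continuousOn hbarrier)
    (fun x hx => (hbarrier x (Ico_subset_Icc_self hx)).hasDerivWithinAt) ?_ (right_mem_Icc.2 hab)
  · have hδη : δ * (1 + b - a) = η := div_mul_cancel₀ η (by linarith)
    rwa [hδη] at hle
  · intro x hx hux
    have hx' := Ico_subset_Icc_self hx
    have hgrowth : ψ a ≤ ψ x := hmono (left_mem_Icc.2 hab) hx' hx.1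
    have hslack : 0 < δ * (1 + x - a) := mul_pos hδ (by linarith [hx.1])
    linarith [h x hx' (by linarith)]

lemma left_le_sub_of_neg_deriv_le_of_pos (hab : a ≤ b)
    (hu : ∀ x ∈ Icc a b, HasDerivAt u (u' x) x) (hψ : ∀ x ∈ Icc a b, HasDerivAt ψ (ψ' x) x)
    (hψ' : ∀ x ∈ Icc a b, 0 ≤ ψ' x) (h : ∀ x ∈ Icc a b, 0 < u x → -u' x ≤ ψ' x)
    (hb : u b ≤ 0) : u a ≤ ψ b - ψ a := by
  have hmem : ∀ x ∈ Icc (-b) (-a), -x ∈ Icc a b := fun x hx =>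
    ⟨le_neg_of_le_neg hx.2, neg_le.1 hx.1⟩
  have hreflected := right_le_sub_of_deriv_le_of_pos (u := fun x => u (-x)) (ψ := fun x => -ψ (-x))
    (neg_le_neg hab) (fun x hx => (hu (-x) (hmem x hx)).scomp x (hasDerivAt_neg x))
    (fun x hx => ((hψ (-x) (hmem x hx)).scomp x (hasDerivAt_neg x)).neg)
    (fun x hx => by simpa using hψ' _ (hmem x hx))
    (fun x hx hux => by simpa using h _ (hmem x hx) hux) (by simpa using hb)
  simp only [neg_neg] at hreflected
  linarith

end Comparison

section Threshold

/-- The Gaussian curve through `(εs, 1 / 2)` with which the probability of an increasing set is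
compared. -/
noncomputable def gaussianThreshold (W : ℕ) (εs p : ℝ) : ℝ :=
  stdNormalCDF (√W * (√(-Real.log εs) - √(-Real.log p)))

lemma gaussianThreshold_self (W : ℕ) (εs : ℝ) : gaussianThreshold W εs εs = 1 / 2 := by
  rw [gaussianThreshold, sub_self, mul_zero, stdNormalCDF_zero]

lemma hasDerivAt_gaussianThreshold (W : ℕ) (εs : ℝ) {p : ℝ} (hp : p ∈ Ioo 0 1) :
    HasDerivAt (gaussianThreshold W εs)
      (√W / (2 * √(-Real.log p)) * gaussianProfile (gaussianThreshold W εs p) / p) p := by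
  have hlog := neg_log_pos hp
  have := Real.sqrt_pos.2 hlog
  refine ((hasDerivAt_stdNormalCDF _).comp p ((((Real.hasDerivAt_log hp.1.ne').neg.sqrt
    hlog.ne').const_sub √(-Real.log εs)).const_mul √W)).congr_deriv ?_
  rw [gaussianThreshold, gaussianProfile_stdNormalCDF]
  simp only [Pi.neg_apply]
  field_simp

lemma sqrt_mul_sqrt_le_add_ite (W h : ℕ) :
    √W * √h ≤ h + √W * if h ≤ W then √h else 0 := by
  split_ifs with hhW
  · exact le_add_of_nonneg_left h.cast_nonneg
  · rw [mul_zero, add_zero]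
    calc √W * √h ≤ √h * √h := by
          gcongr
          exact (not_le.1 hhW).le
      _ = h := Real.mul_self_sqrt h.cast_nonneg

variable {n : ℕ} {S : Set (Fin n → Bool)} {p : ℝ}

/-- The part of the expected square root of the number of pivotal coordinates that comes from the
points with at most `W` of them. -/
noncomputable def smallPivotalExp (S : Set (Fin n → Bool)) (W : ℕ) (p : ℝ) : ℝ :=
  bernoulliExp p fun x => if (pivotal S x).card ≤ W then √(pivotal S x).card else 0

lemma smallPivotalExp_nonneg (hp : p ∈ Icc 0 1) (W : ℕ) : 0 ≤ smallPivotalExp S W p :=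
  bernoulliExp_nonneg hp fun _ => ite_nonneg (Real.sqrt_nonneg _) le_rfl

lemma sqrt_mul_gaussianProfile_le (hS : IsUpperSet S) (hp : p ∈ Ioo 0 1) (W : ℕ) :
    √W / (2 * √(-Real.log p)) * gaussianProfile (bernoulliProb p S) ≤
      bernoulliExp p (fun x => ((pivotal S x).card : ℝ)) + √W * smallPivotalExp S W p := by
  have hsqrt := Real.sqrt_pos.2 (neg_log_pos hp)
  have hpI := Ioo_subset_Icc_self hp
  calc √W / (2 * √(-Real.log p)) * gaussianProfile (bernoulliProb p S)
      ≤ √W / (2 * √(-Real.log p)) *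
          (2 * √(-Real.log p) * bernoulliExp p (fun x => √(pivotal S x).card)) := by
        gcongr
        exact gaussianProfile_bernoulliProb_le hS hpI
    _ = bernoulliExp p (fun x => √W * √(pivotal S x).card) := by
        rw [bernoulliExp_const_mul]
        field_simp
    _ ≤ bernoulliExp p (fun x => (pivotal S x).card +
          √W * if (pivotal S x).card ≤ W then √(pivotal S x).card else 0) :=
        bernoulliExp_mono hpI fun x => sqrt_mul_sqrt_le_add_ite W _
    _ = bernoulliExp p (fun x => ((pivotal S x).card : ℝ)) + √W * smallPivotalExp S W p := by
        rw [bernoulliExp_add, bernoulliExp_const_mul, smallPivotalExp]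

lemma gaussianThreshold_deriv_sub_le {W : ℕ} {εs d : ℝ} (hS : IsUpperSet S) (hp : p ∈ Ioo 0 1)
    (hd : √W * smallPivotalExp S W p ≤ p * d)
    (hle : gaussianProfile (gaussianThreshold W εs p) ≤ gaussianProfile (bernoulliProb p S)) :
    √W / (2 * √(-Real.log p)) * gaussianProfile (gaussianThreshold W εs p) / p -
      bernoulliExp p (fun x => ((pivotal S x).card : ℝ)) / p ≤ d := by
  rw [← sub_div, div_le_iff₀' hp.1, sub_le_iff_le_add']
  calc √W / (2 * √(-Real.log p)) * gaussianProfile (gaussianThreshold W εs p)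
      ≤ √W / (2 * √(-Real.log p)) * gaussianProfile (bernoulliProb p S) := by gcongr
    _ ≤ bernoulliExp p (fun x => ((pivotal S x).card : ℝ)) + √W * smallPivotalExp S W p :=
        sqrt_mul_gaussianProfile_le hS hp W
    _ ≤ bernoulliExp p (fun x => ((pivotal S x).card : ℝ)) + p * d := by gcongr

variable {W : ℕ} {ψ ψ' : ℝ → ℝ} {a b : ℝ}

lemma nonneg_of_smallPivotalExp_le {d : ℝ} (hp : p ∈ Ioo 0 1)
    (hd : √W * smallPivotalExp S W p ≤ p * d) : 0 ≤ d :=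
  nonneg_of_mul_nonneg_right ((mul_nonneg (Real.sqrt_nonneg _)
    (smallPivotalExp_nonneg (Ioo_subset_Icc_self hp) W)).trans hd) hp.1

lemma bernoulliProb_le_gaussianThreshold_add (hS : IsUpperSet S) (ha : 0 < a) (hab : a ≤ b)
    (hb : b < 1) (hψ : ∀ p ∈ Icc a b, HasDerivAt ψ (ψ' p) p)
    (hbound : ∀ p ∈ Icc a b, √W * smallPivotalExp S W p ≤ p * ψ' p)
    (hhalf : bernoulliProb b S ≤ 1 / 2) :
    bernoulliProb a S ≤ gaussianThreshold W b a + (ψ b - ψ a) := by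
  have hIoo : ∀ p ∈ Icc a b, p ∈ Ioo 0 1 := fun p hp => ⟨ha.trans_le hp.1, hp.2.trans_lt hb⟩
  rw [← sub_le_iff_le_add']
  refine left_le_sub_of_neg_deriv_le_of_pos (u := fun p => bernoulliProb p S -
    gaussianThreshold W b p) hab
    (fun p hp => (hasDerivAt_bernoulliProb hS (hIoo p hp).1.ne').sub
      (hasDerivAt_gaussianThreshold W b (hIoo p hp)))
    hψ (fun p hp => nonneg_of_smallPivotalExp_le (hIoo p hp) (hbound p hp))
    (fun p hp hpos => ?_) (by rwa [gaussianThreshold_self, sub_nonpos])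
  have hprob_le : bernoulliProb p S ≤ 1 / 2 :=
    (monotoneOn_bernoulliProb hS (hIoo p hp) (hIoo b (right_mem_Icc.2 hab)) hp.2).trans hhalf
  have hlt : gaussianThreshold W b p < bernoulliProb p S := sub_pos.1 hpos
  rw [neg_sub]
  exact gaussianThreshold_deriv_sub_le hS (hIoo p hp) (hbound p hp)
    (monotoneOn_gaussianProfile (hlt.le.trans hprob_le) hprob_le hlt.le)

lemma gaussianThreshold_sub_le_bernoulliProb (hS : IsUpperSet S) (ha : 0 < a) (hab : a ≤ b)
    (hb : b < 1) (hψ : ∀ p ∈ Icc a b, HasDerivAt ψ (ψ' p) p)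
    (hbound : ∀ p ∈ Icc a b, √W * smallPivotalExp S W p ≤ p * ψ' p)
    (hhalf : 1 / 2 ≤ bernoulliProb a S) :
    gaussianThreshold W a b - (ψ b - ψ a) ≤ bernoulliProb b S := by
  have hIoo : ∀ p ∈ Icc a b, p ∈ Ioo 0 1 := fun p hp => ⟨ha.trans_le hp.1, hp.2.trans_lt hb⟩
  rw [sub_le_comm]
  refine right_le_sub_of_deriv_le_of_pos (u := fun p => gaussianThreshold W a p -
    bernoulliProb p S) hab
    (fun p hp => (hasDerivAt_gaussianThreshold W a (hIoo p hp)).sub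
      (hasDerivAt_bernoulliProb hS (hIoo p hp).1.ne'))
    hψ (fun p hp => nonneg_of_smallPivotalExp_le (hIoo p hp) (hbound p hp))
    (fun p hp hpos => ?_) (by rwa [gaussianThreshold_self, sub_nonpos])
  have hprob_ge : 1 / 2 ≤ bernoulliProb p S :=
    hhalf.trans (monotoneOn_bernoulliProb hS (hIoo a (left_mem_Icc.2 hab)) (hIoo p hp) hp.1)
  have hlt : bernoulliProb p S < gaussianThreshold W a p := sub_pos.1 hpos
  exact gaussianThreshold_deriv_sub_le hS (hIoo p hp) (hbound p hp)
    (antitoneOn_gaussianProfile hprob_ge (hprob_ge.trans hlt.le) hlt.le)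

end Threshold

section Code

variable {N : ℕ} {C : Submodule (ZMod 2) (Fin N → ZMod 2)} {e : Fin N → Bool} {i : Fin N}

/-- The erasure patterns that contain the support of the word `c`. -/
def coveringPatterns (c : Fin N → ZMod 2) : Set (Fin N → Bool) := {e | ∀ i, c i ≠ 0 → e i = true}

lemma bernoulliProb_coveringPatterns (p : ℝ) (c : Fin N → ZMod 2) :
    bernoulliProb p (coveringPatterns c) = p ^ hammingNorm c := by
  simpa [coveringPatterns, hammingNorm] using
    bernoulliProb_forall_mem_eq_true p (Finset.univ.filter (c · ≠ 0))

/-- The nonzero codewords whose support is contained in the erasure pattern `e`: the differences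
between the transmitted codeword and the other candidates compatible with what is received. -/
def coveredCodewords (C : Submodule (ZMod 2) (Fin N → ZMod 2)) (e : Fin N → Bool) :
    Set (Fin N → ZMod 2) :=
  {c | c ∈ C ∧ c ≠ 0 ∧ e ∈ coveringPatterns c}

/-- The erasure patterns that cover some nonzero codeword. -/
def uncorrectable (C : Submodule (ZMod 2) (Fin N → ZMod 2)) : Set (Fin N → Bool) :=
  {e | (coveredCodewords C e).Nonempty}

lemma monotone_coveredCodewords : Monotone (coveredCodewords C) :=
  fun _ _ hee' _ hc => ⟨hc.1, hc.2.1, fun i hi => top_le_iff.1 ((hc.2.2 i hi).ge.trans (hee' i))⟩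

lemma isUpperSet_uncorrectable : IsUpperSet (uncorrectable C) :=
  fun _ _ hee' he => he.mono (monotone_coveredCodewords hee')

lemma mem_coveredCodewords_update_false {c : Fin N → ZMod 2} :
    c ∈ coveredCodewords C (Function.update e i false) ↔ c ∈ coveredCodewords C e ∧ c i = 0 := by
  constructor
  · rintro ⟨hc, hc0, h⟩
    refine ⟨⟨hc, hc0, fun j hj => ?_⟩, by simpa using h i⟩
    have hji := h j hj
    rw [Function.update_apply] at hji
    split_ifs at hji
    exact hji
  · rintro ⟨⟨hc, hc0, h⟩, hi⟩
    refine ⟨hc, hc0, fun j hj => ?_⟩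
    rw [Function.update_of_ne (by rintro rfl; exact hj hi), h j hj]

lemma mem_pivotal_uncorrectable : i ∈ pivotal (uncorrectable C) e ↔
    (coveredCodewords C e).Nonempty ∧ ∀ c ∈ coveredCodewords C e, c i ≠ 0 := by
  simp only [mem_pivotal, uncorrectable, mem_ofPred_eq, not_nonempty_iff_eq_empty,
    eq_empty_iff_forall_notMem, mem_coveredCodewords_update_false, not_and, ne_eq]

/-- Two codewords both equal to `1` at a pivotal position have a difference vanishing there. -/
lemma subsingleton_coveredCodewords (hi : i ∈ pivotal (uncorrectable C) e) :
    (coveredCodewords C e).Subsingleton := by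
  intro c hc c' hc'
  have hpivotal := (mem_pivotal_uncorrectable.1 hi).2
  have hone : ∀ z : ZMod 2, z ≠ 0 → z = 1 := by decide
  by_contra hne
  refine hpivotal (c - c') ⟨C.sub_mem hc.1 hc'.1, sub_ne_zero.2 hne, fun j hj => ?_⟩ ?_
  · by_contra hej
    have hcj : c j = 0 := by_contra fun h => hej (hc.2.2 j h)
    have hcj' : c' j = 0 := by_contra fun h => hej (hc'.2.2 j h)
    exact hj (by rw [Pi.sub_apply, hcj, hcj', sub_zero])
  · rw [Pi.sub_apply, hone _ (hpivotal c hc), hone _ (hpivotal c' hc'), sub_self]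

lemma exists_hammingNorm_eq_card_pivotal (h : (pivotal (uncorrectable C) e).Nonempty) :
    ∃ c ∈ coveredCodewords C e, hammingNorm c = (pivotal (uncorrectable C) e).card := by
  obtain ⟨i, hi⟩ := h
  obtain ⟨c, hc⟩ := (mem_pivotal_uncorrectable.1 hi).1
  have hcovered : coveredCodewords C e = {c} :=
    (subsingleton_coveredCodewords hi).eq_singleton_of_mem hc
  refine ⟨c, hc, congrArg Finset.card ?_⟩
  ext j
  simp [mem_pivotal_uncorrectable, hcovered]

open Classical in
/-- The codewords of Hamming weight `w`, as a finite set to sum over. -/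
noncomputable def codewordsOfWeight (C : Submodule (ZMod 2) (Fin N → ZMod 2)) (w : ℕ) :
    Finset (Fin N → ZMod 2) :=
  {c | c ∈ C ∧ hammingNorm c = w}

lemma mem_codewordsOfWeight {c : Fin N → ZMod 2} {w : ℕ} :
    c ∈ codewordsOfWeight C w ↔ c ∈ C ∧ hammingNorm c = w := by
  simp [codewordsOfWeight]

lemma card_codewordsOfWeight (w : ℕ) : (codewordsOfWeight C w).card = weightDistribution C w := by
  rw [weightDistribution, ← ncard_coe_finset]
  congr 1
  ext c
  exact mem_codewordsOfWeight

lemma ite_sqrt_card_pivotal_le (W : ℕ) (e : Fin N → Bool) :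
    (if (pivotal (uncorrectable C) e).card ≤ W then
      √(pivotal (uncorrectable C) e).card else 0) ≤
    ∑ w ∈ Finset.Icc 1 W, ∑ c ∈ codewordsOfWeight C w,
      √w * (coveringPatterns c).indicator 1 e := by
  have hterm : ∀ (w : ℕ) (c : Fin N → ZMod 2),
      0 ≤ √w * (coveringPatterns c).indicator 1 e :=
    fun w c => mul_nonneg (Real.sqrt_nonneg _) (indicator_nonneg (fun _ _ => zero_le_one) e)
  have hsum := Finset.sum_nonneg fun w (_ : w ∈ Finset.Icc 1 W) =>
    Finset.sum_nonneg fun c (_ : c ∈ codewordsOfWeight C w) => hterm w c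
  split_ifs with hW
  swap; · exact hsum
  rcases (pivotal (uncorrectable C) e).eq_empty_or_nonempty with hempty | hne
  · simpa only [hempty, Finset.card_empty, Nat.cast_zero, Real.sqrt_zero] using hsum
  obtain ⟨c, ⟨hc, -, hce⟩, hweight⟩ := exists_hammingNorm_eq_card_pivotal hne
  set h := (pivotal (uncorrectable C) e).card
  calc √h = √h * (coveringPatterns c).indicator 1 e := by
        rw [indicator_of_mem hce, Pi.one_apply, mul_one]
    _ ≤ ∑ c ∈ codewordsOfWeight C h,
          √h * (coveringPatterns c).indicator 1 e :=
        Finset.single_le_sum (fun c _ => hterm h c) (mem_codewordsOfWeight.2 ⟨hc, hweight⟩)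
    _ ≤ _ := Finset.single_le_sum
        (f := fun w : ℕ => ∑ c ∈ codewordsOfWeight C w,
          √w * (coveringPatterns c).indicator 1 e)
        (fun w _ => Finset.sum_nonneg fun c _ => hterm w c)
        (Finset.mem_Icc.2 ⟨Finset.card_pos.2 hne, hW⟩)

lemma smallPivotalExp_uncorrectable_le {p : ℝ} (hp : p ∈ Icc 0 1) (W : ℕ) :
    smallPivotalExp (uncorrectable C) W p ≤
      ∑ w ∈ Finset.Icc 1 W, √w * weightDistribution C w * p ^ w := by
  refine (bernoulliExp_mono hp (ite_sqrt_card_pivotal_le W)).trans_eq ?_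
  rw [bernoulliExp_sum]
  refine Finset.sum_congr rfl fun w _ => ?_
  rw [bernoulliExp_sum, ← card_codewordsOfWeight, mul_right_comm, mul_comm, ← nsmul_eq_mul]
  refine Finset.sum_eq_card_nsmul fun c hc => ?_
  rw [bernoulliExp_const_mul, ← bernoulliProb, bernoulliProb_coveringPatterns,
    (mem_codewordsOfWeight.1 hc).2]

/-- The potential whose derivative dominates the contribution of the codewords of weight at most
`W` to `smallPivotalExp`. -/
noncomputable def smallWeightPotential (C : Submodule (ZMod 2) (Fin N → ZMod 2)) (W : ℕ)
    (p : ℝ) : ℝ :=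
  √W * ∑ w ∈ Finset.Icc 1 W, weightDistribution C w / √w * p ^ w

lemma hasDerivAt_smallWeightPotential (W : ℕ) {p : ℝ} (hp : p ≠ 0) :
    HasDerivAt (smallWeightPotential C W)
      (√W / p * ∑ w ∈ Finset.Icc 1 W, √w * weightDistribution C w * p ^ w) p := by
  refine ((HasDerivAt.fun_sum fun w _ =>
    (hasDerivAt_pow w p).const_mul (weightDistribution C w / √w)).const_mul √W).congr_deriv ?_
  rw [div_mul_eq_mul_div, mul_div_assoc, Finset.sum_div]
  congr! 2 with w hw
  have hw0 : w ≠ 0 := Nat.one_le_iff_ne_zero.1 (Finset.mem_Icc.1 hw).1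
  calc weightDistribution C w / √w * (w * p ^ (w - 1))
      = w / √w * weightDistribution C w * p ^ (w - 1) := by ring
    _ = √w * weightDistribution C w * p ^ w / p := by
        rw [Real.div_sqrt, ← pow_sub_one_mul hw0 p, mul_div_assoc, mul_div_cancel_right₀ _ hp]

lemma sqrt_mul_smallPivotalExp_uncorrectable_le {p : ℝ} (hp : p ∈ Ioo 0 1) (W : ℕ) :
    √W * smallPivotalExp (uncorrectable C) W p ≤
      p * (√W / p * ∑ w ∈ Finset.Icc 1 W, √w * weightDistribution C w * p ^ w) := by
  rw [← mul_assoc, mul_div_cancel₀ _ hp.1.ne']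
  gcongr
  exact smallPivotalExp_uncorrectable_le (Ioo_subset_Icc_self hp) W

lemma one_sub_pow_le_sqrt {a : ℝ} (ha : a ∈ Ioo 0 1) (w : ℕ) :
    1 - a ^ w ≤ √w * √(-Real.log a) := by
  rw [← Real.sqrt_mul w.cast_nonneg]
  have hpow0 : 0 < a ^ w := pow_pos ha.1 w
  have hpow1 : a ^ w ≤ 1 := pow_le_one₀ ha.1.le ha.2.le
  have hlog : 1 - a ^ w ≤ w * -Real.log a := by
    have := Real.log_le_sub_one_of_pos hpow0
    rw [Real.log_pow] at this
    linarith
  exact Real.le_sqrt_of_sq_le (by nlinarith)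

lemma smallWeightPotential_sub_le (W : ℕ) {a b : ℝ} (ha : a ∈ Ioo 0 1) (hb : b ∈ Icc 0 1) :
    smallWeightPotential C W b - smallWeightPotential C W a ≤
      √(-Real.log a) * √W * truncWeightEnumerator C W b := by
  have hpow : ∀ w ∈ Finset.Icc 1 W,
      (b ^ w - a ^ w) / √w ≤ √(-Real.log a) * b ^ w := by
    intro w hw
    have hw0 : (0 : ℝ) < w := Nat.cast_pos.2 (Finset.mem_Icc.1 hw).1
    rw [div_le_iff₀ (Real.sqrt_pos.2 hw0)]
    calc b ^ w - a ^ w ≤ b ^ w * (1 - a ^ w) := by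
          nlinarith [pow_pos ha.1 w, pow_le_one₀ (n := w) hb.1 hb.2]
      _ ≤ b ^ w * (√w * √(-Real.log a)) :=
          mul_le_mul_of_nonneg_left (one_sub_pow_le_sqrt ha w) (pow_nonneg hb.1 w)
      _ = √(-Real.log a) * b ^ w * √w := by ring
  calc smallWeightPotential C W b - smallWeightPotential C W a
      = √W * ∑ w ∈ Finset.Icc 1 W, weightDistribution C w * ((b ^ w - a ^ w) / √w) := by
        rw [smallWeightPotential, smallWeightPotential, ← mul_sub, ← Finset.sum_sub_distrib]
        congr! 2 with w
        ring
    _ ≤ √W * ∑ w ∈ Finset.Icc 1 W, weightDistribution C w * (√(-Real.log a) * b ^ w) := by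
        gcongr with w hw
        exact hpow w hw
    _ = √(-Real.log a) * √W * truncWeightEnumerator C W b := by
        simp only [truncWeightEnumerator, mul_left_comm _ √(-Real.log a), ← Finset.mul_sum]
        ring

lemma truncWeightEnumerator_nonneg (W : ℕ) {z : ℝ} (hz : 0 ≤ z) :
    0 ≤ truncWeightEnumerator C W z :=
  Finset.sum_nonneg fun _ _ => mul_nonneg (Nat.cast_nonneg _) (pow_nonneg hz _)

lemma mul_truncWeightEnumerator_le_two_mul (W : ℕ) {c z : ℝ} (hc : 0 ≤ c) (hz : 0 ≤ z) :
    c * √W * truncWeightEnumerator C W z ≤ 2 * c * √W * truncWeightEnumerator C W z := by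
  have := truncWeightEnumerator_nonneg (C := C) W hz
  gcongr
  exact le_mul_of_one_le_left hc one_le_two

end Code

section Channel

variable {N : ℕ} {C : Submodule (ZMod 2) (Fin N → ZMod 2)} {ε : ℝ} {x : Fin N → ZMod 2}

/-- The word received when `x` is sent and the positions in `e` are erased. -/
def erase (x : Fin N → ZMod 2) (e : Fin N → Bool) : Fin N → Option (ZMod 2) :=
  fun i => if e i then none else some (x i)

lemma isNone_erase (x : Fin N → ZMod 2) (e : Fin N → Bool) (i : Fin N) :
    (erase x e i).isNone = e i := by
  cases h : e i <;> simp [erase, h]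

lemma erase_injective (x : Fin N → ZMod 2) : Function.Injective (erase x) := by
  intro e e' h
  ext i
  rw [← isNone_erase x e, h, isNone_erase]

lemma becProb_erase (ε : ℝ) (x : Fin N → ZMod 2) (e : Fin N → Bool) :
    becProb ε x (erase x e) = ∏ i, if e i then ε else 1 - ε := by
  refine Finset.prod_congr rfl fun i _ => ?_
  cases h : e i <;> simp [erase, becLetter, h]

lemma becProb_eq_zero (ε : ℝ) {y : Fin N → Option (ZMod 2)} (hy : y ∉ range (erase x)) :
    becProb ε x y = 0 := by
  contrapose! hy
  refine ⟨fun i => (y i).isNone, funext fun i => ?_⟩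
  have hi : becLetter ε (x i) (y i) ≠ 0 := Finset.prod_ne_zero_iff.1 hy i (Finset.mem_univ i)
  cases hyi : y i with
  | none => simp [erase, hyi]
  | some c =>
    have hc : c = x i := by
      by_contra hne
      exact hi (by simp [becLetter, hyi, hne])
    simp [erase, hyi, hc]

lemma isBlockMAPError_erase_iff (hε : ε ∈ Ioo 0 1) (hx : x ∈ C) (e : Fin N → Bool) :
    IsBlockMAPError C ε x (erase x e) ↔ e ∈ uncorrectable C := by
  constructor
  · rintro ⟨x', hx', hne, hle⟩
    have hpos : 0 < becProb ε x (erase x e) := by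
      rw [becProb_erase]
      exact Finset.prod_pos fun i _ => by split_ifs <;> linarith [hε.1, hε.2]
    refine ⟨x' - x, C.sub_mem hx' hx, sub_ne_zero.2 hne, fun i hi => ?_⟩
    have hletter := Finset.prod_ne_zero_iff.1 (hpos.trans_le hle).ne' i (Finset.mem_univ i)
    have hxi : x i ≠ x' i := fun h => hi (by rw [Pi.sub_apply, h, sub_self])
    by_contra he
    exact hletter (by simp [erase, he, becLetter, hxi])
  · rintro ⟨c, hc, hc0, hce⟩
    refine ⟨x + c, C.add_mem hx hc, by simpa using hc0, le_of_eq ?_⟩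
    refine Finset.prod_congr rfl fun i _ => ?_
    by_cases hi : c i = 0
    · rw [Pi.add_apply, hi, add_zero]
    · simp [erase, hce i hi, becLetter]

open Classical in
lemma sum_becProb_isBlockMAPError (hε : ε ∈ Ioo 0 1) (hx : x ∈ C) :
    ∑ y, (if IsBlockMAPError C ε x y then becProb ε x y else 0) =
      bernoulliProb ε (uncorrectable C) := by
  refine (Finset.sum_of_injOn (erase x) (erase_injective x).injOn
    (fun _ _ => Finset.mem_coe.2 (Finset.mem_univ _)) (fun y _ hy => ?_) fun e _ => ?_).symm
  · rw [becProb_eq_zero ε (by simpa using hy), ite_self]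
  · simp only [isBlockMAPError_erase_iff hε hx, becProb_erase, indicator_apply, Pi.one_apply,
      mul_ite, mul_one, mul_zero]

lemma blockMAPErrorProb_eq_bernoulliProb (hε : ε ∈ Ioo 0 1) :
    blockMAPErrorProb C ε = bernoulliProb ε (uncorrectable C) := by
  classical
  rw [blockMAPErrorProb, Finset.sum_congr rfl fun x _ => congrArg _ <|
    (sum_becProb_isBlockMAPError hε x.2), Finset.sum_const, Finset.card_univ, nsmul_eq_mul,
    ← mul_assoc, mul_one_div_cancel (Nat.cast_ne_zero.2 Fintype.card_ne_zero), one_mul]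

end Channel

theorem theorem2_general {N : ℕ} (C : Submodule (ZMod 2) (Fin N → ZMod 2)) {εs : ℝ}
    (hεs0 : 0 < εs) (hεs1 : εs < 1) (W : ℕ) :
    (blockMAPErrorProb C εs ≤ 1 / 2 → ∀ ε : ℝ, 0 < ε → ε < εs →
      blockMAPErrorProb C ε ≤
        stdNormalCDF (√W * (√(-Real.log εs) - √(-Real.log ε))) +
          √(-Real.log ε) * √W * truncWeightEnumerator C W εs) ∧
    (1 / 2 ≤ blockMAPErrorProb C εs → ∀ ε : ℝ, εs < ε → ε < 1 →
      stdNormalCDF (√W * (√(-Real.log εs) - √(-Real.log ε))) -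
          √(-Real.log εs) * √W * truncWeightEnumerator C W ε ≤
        blockMAPErrorProb C ε) := by
  rw [blockMAPErrorProb_eq_bernoulliProb ⟨hεs0, hεs1⟩]
  refine ⟨fun hhalf ε hε0 hε => ?_, fun hhalf ε hε hε1 => ?_⟩
  · have hεI : ε ∈ Ioo 0 1 := ⟨hε0, hε.trans hεs1⟩
    rw [blockMAPErrorProb_eq_bernoulliProb hεI]
    refine (bernoulliProb_le_gaussianThreshold_add isUpperSet_uncorrectable hε0 hε.le hεs1
      (fun p hp => hasDerivAt_smallWeightPotential W (hε0.trans_le hp.1).ne')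
      (fun p hp => sqrt_mul_smallPivotalExp_uncorrectable_le
        ⟨hε0.trans_le hp.1, hp.2.trans_lt hεs1⟩ W) hhalf).trans ?_
    exact add_le_add_right (smallWeightPotential_sub_le W hεI ⟨hεs0.le, hεs1.le⟩) _
  · have hε0 : 0 < ε := hεs0.trans hε
    rw [blockMAPErrorProb_eq_bernoulliProb ⟨hε0, hε1⟩]
    refine le_trans ?_ (gaussianThreshold_sub_le_bernoulliProb isUpperSet_uncorrectable hεs0 hε.le
      hε1 (fun p hp => hasDerivAt_smallWeightPotential W (hεs0.trans_le hp.1).ne')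
      (fun p hp => sqrt_mul_smallPivotalExp_uncorrectable_le
        ⟨hεs0.trans_le hp.1, hp.2.trans_lt hε1⟩ W) hhalf)
    exact sub_le_sub_left (smallWeightPotential_sub_le W ⟨hεs0, hεs1⟩ ⟨hε0.le, hε1.le⟩) _

theorem theorem2 (N : ℕ) (C : Submodule (ZMod 2) (Fin N → ZMod 2))
    (εs : ℝ) (hεs0 : 0 < εs) (hεs1 : εs < 1) (hεs : blockMAPErrorProb C εs = 1 / 2)
    (W : ℕ) (hW1 : 1 ≤ W) (hWN : W ≤ N) :
    (∀ ε : ℝ, 0 < ε → ε < εs →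
      blockMAPErrorProb C ε ≤
        stdNormalCDF (Real.sqrt W * (Real.sqrt (-Real.log εs) - Real.sqrt (-Real.log ε)))
          + 2 * Real.sqrt (-Real.log ε) * Real.sqrt W * truncWeightEnumerator C W εs) ∧
    (∀ ε : ℝ, εs < ε → ε < 1 →
      stdNormalCDF (Real.sqrt W * (Real.sqrt (-Real.log εs) - Real.sqrt (-Real.log ε)))
          - 2 * Real.sqrt (-Real.log εs) * Real.sqrt W * truncWeightEnumerator C W ε
        ≤ blockMAPErrorProb C ε) := by
  have hle {c z : ℝ} := mul_truncWeightEnumerator_le_two_mul (C := C) (c := c) (z := z) W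
  exact ⟨fun ε hε0 hε => ((theorem2_general C hεs0 hεs1 W).1 hεs.le ε hε0 hε).trans
      (add_le_add_right (hle (Real.sqrt_nonneg _) hεs0.le) _),
    fun ε hε hε1 => (sub_le_sub_left (hle (Real.sqrt_nonneg _) (hεs0.trans hε).le) _).trans
      ((theorem2_general C hεs0 hεs1 W).2 hεs.ge ε hε hε1)⟩
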